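/- Let $I^d=[0,1]^d$. All mesh sizes are of the form $h_i=2^{-\ell_i}$, $\ell_i\in\mathbb N_0$. For $S\subset\{1,\dots,d\}$ let $I_h^{(S)}=\{x\in I^d:\ x_i\in h_i\mathbb Z \text{ for } i\in S\}$, $I_h=I_h^{(\{1,\dots,d\})}$, and let $X_h^{(S)}$ be the space of functions on $I_h^{(S)}$ that are smooth in the continuous variables (the restrictions to $I_h^{(S)}$ of functions in $C^\infty(I^d)$). Write $h_S=(h_i)_{i\in S}$. For every $S$ and every $h_S$ let $A_h^{(S)}:X_h^{(S)}\to X_h^{(S)}$ be a linear operator (the semi-discretisation, in the directions of $S$, of $A:=A^{(\emptyset)}:C^\infty(I^d)\to C^\infty(I^d)$), and put $A_h:=A_h^{(\{1,\dots,d\})}$. Let $V_S$ be the set of functions $w(x;h_S)$ that are $C^\infty$ on $I^d\times[-1,1]^{S}$, even in each mesh size $h_i$, $i\in S$, and satisfy $\partial_x^\alpha w=0$ on $\partial I^d$ for all multi-indices $\alpha$. Functions in $V_S$ and in $C^\infty(I^d)$ are restricted to the partial grids where an operator is applied to them. Assume: (1) (Solvability, smoothness and evenness.) For every $S\subset\{1,\dots,d\}$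 and every $g\in V_S$ there is $w\in V_S$ with $A_h^{(S)}w(\cdot;h_S)=g(\cdot;h_S)$ on $I_h^{(S)}$ for all $h$. (2) (Truncation error.) For every $S$ and every $w\in V_S$ there are $\hat\sigma_J\in V_{J\cup S}$, for $\emptyset\ne J\subset\{1,\dots,d\}\setminus S$, such that for all $h$, on $I_h$, $$\bigl[A_h^{(S)}-A_h\bigr]w(\cdot;h_S)=\sum_{\emptyset\neq J\subset\{1,\dots,d\}\setminus S}\Bigl(\prod_{j\in J}h_j^2\Bigr)\hat\sigma_J(\cdot;h_J,h_S).$$ Let $f\in C^\infty(I^d)$ and let $u\in C^\infty(I^d)$ solve $Au=f$, with $\partial^\alpha u=0$ on $\partial I^d$ for all $\alpha$. Then there are functions $$\beta_j(\cdot;h_1,\dots,h_{j-1},h_{j+1},\dots,h_d)\in L^\infty\bigl(I_h^{(\{1,\dots,d\}\setminus\{j\})}\bigr),\qquad \gamma_{j_1,\dots,j_m}(\cdot;h_{j_1},\dots,h_{j_m})\in L^\infty\bigl(I_h^{(\{j_1,\dots,j_m\})}\bigr),$$ depending only on the mesh sizes indicated and bounded by a constant independent of all mesh sizes, such that for all $h$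 and every grid function $u_h$ on $I_h$ with $A_hu_h=f$ on $I_h$ and $u_h=0$ on $I_h\cap\partial I^d$, we have on $I_h$ $$u-u_h=\sum_{j=1}^d h_j^2\,\beta_j(\cdot;h_1,\dots,h_{j-1},h_{j+1},\dots,h_d)+\sum_{m=1}^d\ \sum_{\{j_1,\dots,j_m\}\subset\{1,\dots,d\}}h_{j_1}^4\cdots h_{j_m}^4\,\gamma_{j_1,\dots,j_m}(\cdot;h_{j_1},\dots,h_{j_m}).$$ -/

import Mathlib

open scoped ContDiff

noncomputable section

namespace SparseGrid

/-- The closed unit cube `I^d = [0,1]^d`. -/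
def cube (d : ℕ) : Set (Fin d → ℝ) := Set.Icc 0 1

/-- The box `[-1,1]^d` in which the mesh-size vectors `(h_1, …, h_d)` live. -/
def meshBox (d : ℕ) : Set (Fin d → ℝ) := Set.Icc (-1) 1

/-- The topological boundary `∂I^d`: the points of the cube with some coordinate `0` or `1`. -/
def cubeBoundary (d : ℕ) : Set (Fin d → ℝ) := {x | x ∈ cube d ∧ ∃ i, x i = 0 ∨ x i = 1}

/-- The mesh sizes `h_i = 2^{-ℓ_i}` of a vector of levels `ℓ`. -/
def mesh {d : ℕ} (ℓ : Fin d → ℕ) : Fin d → ℝ := fun i => ((2 : ℝ) ^ ℓ i)⁻¹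

/-- The partial grid `I_h^{(S)}`: the coordinates `x_i`, `i ∈ S`, are multiples of
`h_i = 2^{-ℓ_i}`, the remaining coordinates range over `[0,1]`. It only depends on the
levels in the directions of `S`. -/
def partialGrid {d : ℕ} (S : Finset (Fin d)) (ℓ : S → ℕ) : Set (Fin d → ℝ) :=
  {x | x ∈ cube d ∧ ∀ i : S, ∃ k : ℕ, x i = k * ((2 : ℝ) ^ ℓ i)⁻¹}

/-- The full tensor-product grid `I_h = I_h^{(1,…,d)}`. -/
abbrev fullGrid {d : ℕ} (ℓ : Fin d → ℕ) : Set (Fin d → ℝ) :=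
  partialGrid Finset.univ (Finset.univ.restrict ℓ)

/-- A point of the full grid, regarded as a point of the partial grid in the directions `S`. -/
def toPartial {d : ℕ} {ℓ : Fin d → ℕ} (S : Finset (Fin d)) (x : fullGrid ℓ) :
    partialGrid S (S.restrict ℓ) :=
  ⟨x.1, x.2.1, fun i => x.2.2 ⟨i.1, Finset.mem_univ _⟩⟩

/-- The space of functions on the partial grid `I_h^{(S)}` that are smooth in the continuous
variables, i.e. of the restrictions to `I_h^{(S)}` of functions in `C^∞(I^d)`. For `S = ∅` this
is `C^∞(I^d)`, and for `S = {1,…,d}` it is the space of all grid functions on `I_h`. -/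
def smoothGridFun {d : ℕ} (S : Finset (Fin d)) (ℓ : S → ℕ) :
    Submodule ℝ (partialGrid S ℓ → ℝ) where
  carrier := {v | ∃ V : (Fin d → ℝ) → ℝ, ContDiffOn ℝ ∞ V (cube d) ∧ ∀ x, v x = V x}
  add_mem' := by
    rintro a b ⟨V, hV, ha⟩ ⟨W, hW, hb⟩
    exact ⟨fun x => V x + W x, hV.add hW, fun x => by simp [ha, hb]⟩
  zero_mem' := ⟨fun _ => 0, contDiffOn_const, fun _ => rfl⟩
  smul_mem' := by
    rintro c a ⟨V, hV, ha⟩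
    exact ⟨fun x => c * V x, contDiffOn_const.mul hV, fun x => by simp [ha]⟩

/-- The restriction of a function in `C^∞(I^d)` to the partial grid `I_h^{(S)}`. -/
def sample {d : ℕ} (v : (Fin d → ℝ) → ℝ) (hv : ContDiffOn ℝ ∞ v (cube d))
    (S : Finset (Fin d)) (ℓ : S → ℕ) : smoothGridFun S ℓ :=
  ⟨fun x => v x, v, hv, fun _ => rfl⟩

/-- All partial derivatives (of every order, including the function itself) vanish on `∂I^d`. -/
def FlatOnBoundary {d : ℕ} (v : (Fin d → ℝ) → ℝ) : Prop :=
  ∀ x ∈ cubeBoundary d, ∀ n : ℕ, iteratedFDerivWithin ℝ n v (cube d) x = 0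

/-- A function `w(x; h_{i_1}, …, h_{i_m})` with `S = {i_1, …, i_m}`, which is smooth in
`x ∈ I^d` and in the mesh sizes, even in each mesh size, and all of whose `x`-derivatives vanish
on `∂I^d`. The function is written with all of `h_1, …, h_d` as arguments, and `dependsOn` says
that only those with index in `S` matter. -/
structure MeshFun (d : ℕ) (S : Finset (Fin d)) where
  toFun : (Fin d → ℝ) → (Fin d → ℝ) → ℝ
  smooth : ContDiffOn ℝ ∞ (fun p : (Fin d → ℝ) × (Fin d → ℝ) => toFun p.1 p.2)
    (cube d ×ˢ meshBox d)
  even : ∀ x ∈ cube d, ∀ h ∈ meshBox d, ∀ i,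
    toFun x (Function.update h i (-h i)) = toFun x h
  dependsOn : ∀ x ∈ cube d, ∀ h ∈ meshBox d, ∀ h' ∈ meshBox d,
    (∀ i ∈ S, h i = h' i) → toFun x h = toFun x h'
  flat : ∀ h ∈ meshBox d, FlatOnBoundary (fun x => toFun x h)

theorem mesh_mem_meshBox {d : ℕ} (ℓ : Fin d → ℕ) : mesh ℓ ∈ meshBox d := by
  have h0 : ∀ i, (0 : ℝ) ≤ mesh ℓ i := fun i => by unfold mesh; positivity
  refine ⟨fun i => ?_, fun i => ?_⟩
  · have := h0 i
    simp only [Pi.neg_apply, Pi.one_apply]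
    linarith
  · exact inv_le_one_of_one_le₀ (one_le_pow₀ (by norm_num))

theorem MeshFun.contDiffOn_slice {d : ℕ} {S : Finset (Fin d)} (w : MeshFun d S)
    {h : Fin d → ℝ} (hh : h ∈ meshBox d) : ContDiffOn ℝ ∞ (fun x => w.toFun x h) (cube d) :=
  w.smooth.comp (f := fun x : Fin d → ℝ => (x, h)) (contDiff_id.prodMk contDiff_const).contDiffOn
    (fun _ hx => ⟨hx, hh⟩)

/-- The restriction of `w(· ; h)`, `h_i = 2^{-ℓ_i}`, to the partial grid `I_h^{(T)}`. -/
def MeshFun.sample {d : ℕ} {S : Finset (Fin d)} (w : MeshFun d S) (T : Finset (Fin d))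
    (ℓ : Fin d → ℕ) : smoothGridFun T (T.restrict ℓ) :=
  SparseGrid.sample (fun x => w.toFun x (mesh ℓ)) (w.contDiffOn_slice (mesh_mem_meshBox ℓ)) T
    (T.restrict ℓ)

/-- A family of linear operators `A_h^{(S)}`, one for each set `S` of discretised directions and
each choice of mesh sizes in these directions. `A_h^{(∅)}` is the operator `A` on `C^∞(I^d)`, and
`A_h^{(1,…,d)}` is the fully discrete operator `A_h` on the grid functions on `I_h`. -/
abbrev OperatorFamily (d : ℕ) : Type :=
  (S : Finset (Fin d)) → (ℓ : S → ℕ) → (smoothGridFun S ℓ →ₗ[ℝ] smoothGridFun S ℓ)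

/-- Solvability, smoothness and evenness: for each set `S` of directions and each right-hand side
`g(· ; h_S)`, the problem `A_h^{(S)} w(· ; h_S) = g(· ; h_S)` on `I_h^{(S)}` has a solution
`w(· ; h_S)` in the same class. -/
def Solvable {d : ℕ} (A : OperatorFamily d) : Prop :=
  ∀ (S : Finset (Fin d)) (g : MeshFun d S), ∃ w : MeshFun d S,
    ∀ ℓ : Fin d → ℕ, A S (S.restrict ℓ) (w.sample S ℓ) = g.sample S ℓ

/-- Structure of the truncation error: on the full grid, `[A_h^{(S)} - A_h] w(· ; h_S)` is the
sum, over the nonempty sets `J` of directions disjoint from `S`, of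
`(∏_{j ∈ J} h_j²) σ_J(· ; h_J, h_S)`, with coefficients in the same class. -/
def TruncationExpansion {d : ℕ} (A : OperatorFamily d) : Prop :=
  ∀ (S : Finset (Fin d)) (w : MeshFun d S), ∃ σ : (J : Finset (Fin d)) → MeshFun d (J ∪ S),
    ∀ (ℓ : Fin d → ℕ) (x : fullGrid ℓ),
      (A S (S.restrict ℓ) (w.sample S ℓ)).1 (toPartial S x)
          - (A Finset.univ (Finset.univ.restrict ℓ) (w.sample Finset.univ ℓ)).1 x
        = ∑ J ∈ Sᶜ.powerset.erase ∅, (∏ j ∈ J, mesh ℓ j ^ 2) * (σ J).toFun x (mesh ℓ)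

end SparseGrid

end

namespace SparseGrid

/-! ### Second-order estimates for even functions -/

/-! Taking S = ∅ in the truncation expansion, the residual of `u` in the full discrete equation is a
sum of terms h_J² σ_J. Each is removed by solving A_h e_J = σ_J: a semi-discrete solution in the
directions J solves this up to its own truncation error, whose terms involve strictly more
directions, so the recursion ends (`exists_discrete_solution`). Hence u - u_h is a linear
combination of terms h_T² w_T(x; h_T) with T nonempty and w_T smooth and even in each mesh size.

Such a term splits by inclusion-exclusion over the mesh sizes set to zero
(`MeshFun.prod_mul_mem_expansions`). The full alternating sum is O(h_T²) by evenness, giving h_T⁴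
γ_T (`exists_mixedDifference_le`). Any other summand has some h_j set to zero, so it has the form
h_j² β_j with β_j independent of h_j.

The constructed grid function is the given u_h because A_h is injective on grid functions vanishing
on the boundary. This follows from solvability by a dimension count (`Solvable.discrete_injOn`). -/

theorem abs_sub_zero_le_of_even {φ φ₁ φ₂ : ℝ → ℝ} {M : ℝ}
    (h₁ : ∀ t ∈ Set.Icc (-1 : ℝ) 1, HasDerivWithinAt φ (φ₁ t) (Set.Icc (-1) 1) t)
    (h₂ : ∀ t ∈ Set.Icc (-1 : ℝ) 1, HasDerivWithinAt φ₁ (φ₂ t) (Set.Icc (-1) 1) t)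
    (hM : ∀ t ∈ Set.Icc (-1 : ℝ) 1, |φ₂ t| ≤ M)
    (heven : ∀ t ∈ Set.Icc (-1 : ℝ) 1, φ (-t) = φ t) {t : ℝ} (ht : t ∈ Set.Icc (-1 : ℝ) 1) :
    |φ t - φ 0| ≤ M * t ^ 2 := by
  have hnhds : Set.Icc (-1 : ℝ) 1 ∈ nhds (0 : ℝ) := Icc_mem_nhds (by norm_num) (by norm_num)
  have mem0 : (0 : ℝ) ∈ Set.Icc (-1 : ℝ) 1 := by norm_num
  have hd : HasDerivAt φ (φ₁ 0) 0 := (h₁ 0 mem0).hasDerivAt hnhds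
  -- An even function has zero derivative at 0; two applications of the mean value inequality then
  -- give the quadratic bound, without the sharp factor 1/2.
  have hφ₁ : φ₁ 0 = 0 := by
    have hneg : HasDerivAt (fun t => φ (-t)) (φ₁ 0 * -1) 0 :=
      HasDerivAt.comp (h₂ := φ) (0 : ℝ) (by simpa using hd) (hasDerivAt_neg 0)
    have heq : (fun t => φ (-t)) =ᶠ[nhds 0] φ := Filter.eventually_of_mem hnhds heven
    have := hneg.unique (hd.congr_of_eventuallyEq heq)
    linarith
  have hM0 : 0 ≤ M := (abs_nonneg _).trans (hM 0 mem0)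
  have hb₁ : ∀ s ∈ Set.Icc (-1 : ℝ) 1, |φ₁ s| ≤ M * |s| := fun s hs => by
    simpa [hφ₁] using
      (convex_Icc (-1 : ℝ) 1).norm_image_sub_le_of_norm_hasDerivWithin_le h₂ hM mem0 hs
  have hsub : Set.uIcc 0 t ⊆ Set.Icc (-1 : ℝ) 1 := Set.uIcc_subset_Icc mem0 ht
  have hb : ∀ s ∈ Set.uIcc 0 t, ‖φ₁ s‖ ≤ M * |t| := fun s hs =>
    (hb₁ s (hsub hs)).trans
      (mul_le_mul_of_nonneg_left (by simpa using Set.abs_sub_left_of_mem_uIcc hs) hM0)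
  have := (convex_uIcc 0 t).norm_image_sub_le_of_norm_hasDerivWithin_le
    (fun s hs => (h₁ s (hsub hs)).mono hsub) hb Set.left_mem_uIcc Set.right_mem_uIcc
  calc |φ t - φ 0| ≤ M * |t| * |t| := by simpa using this
    _ = M * t ^ 2 := by rw [mul_assoc, abs_mul_abs_self, sq]

variable {d : ℕ}

/-- The alternating sum of the values of `F x` with the mesh sizes in subsets of `T` set to zero. -/
noncomputable def mixedDifference (F : (Fin d → ℝ) → (Fin d → ℝ) → ℝ) (T : Finset (Fin d))
    (x h : Fin d → ℝ) : ℝ :=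
  ∑ J ∈ T.powerset, (-1) ^ J.card * F x (J.piecewise 0 h)

theorem mixedDifference_insert (F : (Fin d → ℝ) → (Fin d → ℝ) → ℝ) {T : Finset (Fin d)}
    {j : Fin d} (hj : j ∉ T) (x h : Fin d → ℝ) :
    mixedDifference F (insert j T) x h
      = mixedDifference F T x h - mixedDifference F T x (Function.update h j 0) := by
  unfold mixedDifference
  rw [Finset.sum_powerset_insert hj, sub_eq_add_neg, ← Finset.sum_neg_distrib]
  congr 1
  refine Finset.sum_congr rfl fun J hJ => ?_
  have hjJ : j ∉ J := fun h => hj (Finset.mem_powerset.1 hJ h)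
  rw [Finset.card_insert_of_notMem hjJ, Finset.piecewise_insert,
    ← Finset.update_piecewise_of_notMem _ _ _ hjJ, pow_succ, Pi.zero_apply]
  ring

theorem mem_meshBox {h : Fin d → ℝ} : h ∈ meshBox d ↔ ∀ i, h i ∈ Set.Icc (-1 : ℝ) 1 :=
  ⟨fun H i => ⟨H.1 i, H.2 i⟩, fun H => ⟨fun i => (H i).1, fun i => (H i).2⟩⟩

theorem update_mem_meshBox {h : Fin d → ℝ} (hh : h ∈ meshBox d) (j : Fin d) {t : ℝ}
    (ht : t ∈ Set.Icc (-1 : ℝ) 1) : Function.update h j t ∈ meshBox d := by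
  rw [mem_meshBox] at hh ⊢
  intro i
  rcases eq_or_ne i j with rfl | hij
  · simpa using ht
  · simpa [hij] using hh i

theorem piecewise_zero_mem_meshBox {h : Fin d → ℝ} (hh : h ∈ meshBox d) (J : Finset (Fin d)) :
    J.piecewise 0 h ∈ meshBox d := by
  rw [mem_meshBox] at hh ⊢
  intro i
  by_cases hi : i ∈ J
  · simp [hi]
  · simpa [hi] using hh i

theorem uniqueDiffOn_cube_prod_meshBox :
    UniqueDiffOn ℝ (cube d ×ˢ meshBox d) := by
  refine UniqueDiffOn.prod ?_ ?_
  · rw [cube, ← Set.pi_univ_Icc]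
    exact UniqueDiffOn.univ_pi fun i => uniqueDiffOn_Icc (by simp)
  · rw [meshBox, ← Set.pi_univ_Icc]
    exact UniqueDiffOn.univ_pi fun i => uniqueDiffOn_Icc (by simp)

/-- The partial derivative of `F (x, h)` with respect to the mesh size `h j`. -/
noncomputable def meshDeriv (F : (Fin d → ℝ) → (Fin d → ℝ) → ℝ) (j : Fin d) (x h : Fin d → ℝ) : ℝ :=
  fderivWithin ℝ (Function.uncurry F) (cube d ×ˢ meshBox d) (x, h) (0, Pi.single j 1)

theorem contDiffOn_meshDeriv {F : (Fin d → ℝ) → (Fin d → ℝ) → ℝ}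
    (hF : ContDiffOn ℝ ∞ (Function.uncurry F) (cube d ×ˢ meshBox d)) (j : Fin d) :
    ContDiffOn ℝ ∞ (Function.uncurry (meshDeriv F j)) (cube d ×ˢ meshBox d) :=
  (hF.fderivWithin uniqueDiffOn_cube_prod_meshBox (m := ∞) le_rfl).clm_apply contDiffOn_const

theorem hasDerivWithinAt_meshDeriv {F : (Fin d → ℝ) → (Fin d → ℝ) → ℝ}
    (hF : ContDiffOn ℝ ∞ (Function.uncurry F) (cube d ×ˢ meshBox d)) (j : Fin d)
    {x h : Fin d → ℝ} (hx : x ∈ cube d) (hh : h ∈ meshBox d) {t : ℝ}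
    (ht : t ∈ Set.Icc (-1 : ℝ) 1) :
    HasDerivWithinAt (fun s => F x (Function.update h j s))
      (meshDeriv F j x (Function.update h j t)) (Set.Icc (-1) 1) t := by
  have hmem : ∀ s ∈ Set.Icc (-1 : ℝ) 1,
      (x, Function.update h j s) ∈ cube d ×ˢ meshBox d :=
    fun s hs => ⟨hx, update_mem_meshBox hh j hs⟩
  have hc : HasDerivWithinAt (fun s => (x, Function.update h j s)) (0, Pi.single j 1)
      (Set.Icc (-1 : ℝ) 1) t :=
    ((hasDerivAt_const t x).prodMk (hasDerivAt_update h j t)).hasDerivWithinAt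
  exact ((hF.differentiableOn (by simp) _ (hmem t ht)).hasFDerivWithinAt).comp_hasDerivWithinAt t
    hc hmem

/-- Evenness in h_i makes the two slices in h_j the same function, so their derivatives agree. The
restriction i ≠ j is essential: differentiating in h_j itself turns even into odd. -/
theorem meshDeriv_even {F : (Fin d → ℝ) → (Fin d → ℝ) → ℝ}
    (hF : ContDiffOn ℝ ∞ (Function.uncurry F) (cube d ×ˢ meshBox d)) {i j : Fin d} (hij : i ≠ j)
    (heven : ∀ x ∈ cube d, ∀ h ∈ meshBox d, F x (Function.update h i (-h i)) = F x h) :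
    ∀ x ∈ cube d, ∀ h ∈ meshBox d,
      meshDeriv F j x (Function.update h i (-h i)) = meshDeriv F j x h := by
  intro x hx h hh
  have hhj := mem_meshBox.1 hh j
  have hhi := mem_meshBox.1 hh i
  have hneg : Function.update h i (-h i) ∈ meshBox d :=
    update_mem_meshBox hh i ⟨by linarith [hhi.2], by linarith [hhi.1]⟩
  have h₁ := hasDerivWithinAt_meshDeriv hF j hx hneg hhj
  have h₂ := hasDerivWithinAt_meshDeriv hF j hx hh hhj
  have heq : ∀ s ∈ Set.Icc (-1 : ℝ) 1, F x (Function.update h j s)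
      = F x (Function.update (Function.update h i (-h i)) j s) := fun s hs => by
    rw [← heven x hx _ (update_mem_meshBox hh j hs), Function.update_of_ne hij,
      Function.update_comm hij]
  have := (uniqueDiffOn_Icc (by norm_num : (-1 : ℝ) < 1) _ hhj).eq_deriv _
    (h₁.congr heq (heq _ hhj)) h₂
  rwa [Function.update_eq_self, Function.update_comm hij, Function.update_eq_self] at this

theorem hasDerivWithinAt_mixedDifference {F : (Fin d → ℝ) → (Fin d → ℝ) → ℝ}
    (hF : ContDiffOn ℝ ∞ (Function.uncurry F) (cube d ×ˢ meshBox d)) {T : Finset (Fin d)}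
    {j : Fin d} (hj : j ∉ T) {x h : Fin d → ℝ} (hx : x ∈ cube d) (hh : h ∈ meshBox d) {t : ℝ}
    (ht : t ∈ Set.Icc (-1 : ℝ) 1) :
    HasDerivWithinAt (fun s => mixedDifference F T x (Function.update h j s))
      (mixedDifference (meshDeriv F j) T x (Function.update h j t)) (Set.Icc (-1) 1) t := by
  unfold mixedDifference
  refine HasDerivWithinAt.fun_sum fun J hJ => ?_
  have hjJ : j ∉ J := fun h => hj (Finset.mem_powerset.1 hJ h)
  simp only [← Finset.update_piecewise_of_notMem _ _ _ hjJ]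
  exact (hasDerivWithinAt_meshDeriv hF j hx (piecewise_zero_mem_meshBox hh J) ht).const_mul _

theorem isCompact_cube_prod_meshBox : IsCompact (cube d ×ˢ meshBox d) :=
  isCompact_Icc.prod isCompact_Icc

/-- Each direction contributes one factor h_j² through the one-variable estimate. `F` is quantified
inside the induction because the hypothesis is applied to the second derivative of `F` in h_j, which
is still even in the directions of `T`. -/
theorem exists_mixedDifference_le (T : Finset (Fin d)) :
    ∀ F : (Fin d → ℝ) → (Fin d → ℝ) → ℝ,
      ContDiffOn ℝ ∞ (Function.uncurry F) (cube d ×ˢ meshBox d) →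
      (∀ i ∈ T, ∀ x ∈ cube d, ∀ h ∈ meshBox d, F x (Function.update h i (-h i)) = F x h) →
      ∃ C, ∀ x ∈ cube d, ∀ h ∈ meshBox d,
        |mixedDifference F T x h| ≤ C * ∏ j ∈ T, h j ^ 2 := by
  induction T using Finset.induction_on with
  | empty =>
    intro F hF _
    obtain ⟨C, hC⟩ := isCompact_cube_prod_meshBox.exists_bound_of_continuousOn hF.continuousOn
    exact ⟨C, fun x hx h hh => by simpa [mixedDifference] using hC (x, h) ⟨hx, hh⟩⟩
  | insert j T hj ih =>
    intro F hF heven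
    have hevenT : ∀ i ∈ T, ∀ x ∈ cube d, ∀ h ∈ meshBox d,
        F x (Function.update h i (-h i)) = F x h := fun i hi => heven i (Finset.mem_insert_of_mem hi)
    have hF₁ := contDiffOn_meshDeriv hF j
    obtain ⟨C, hC⟩ := ih _ (contDiffOn_meshDeriv hF₁ j) fun i hi => by
      have hij : i ≠ j := ne_of_mem_of_not_mem hi hj
      exact meshDeriv_even hF₁ hij (meshDeriv_even hF hij (hevenT i hi))
    refine ⟨C, fun x hx h hh => ?_⟩
    have hprod : ∀ t, ∏ i ∈ T, Function.update h j t i ^ 2 = ∏ i ∈ T, h i ^ 2 := fun t =>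
      Finset.prod_congr rfl fun i hi => by
        rw [Function.update_of_ne (ne_of_mem_of_not_mem hi hj)]
    -- The slice in h_j of the mixed difference over `T` is even, and its second derivative is the
    -- mixed difference of ∂_j² F, bounded uniformly in t since the product over `T` does not
    -- involve h_j.
    have key := abs_sub_zero_le_of_even (M := C * ∏ i ∈ T, h i ^ 2)
      (fun t ht => hasDerivWithinAt_mixedDifference hF hj hx hh ht)
      (fun t ht => hasDerivWithinAt_mixedDifference hF₁ hj hx hh ht)
      (fun t ht => by
        rw [← hprod t]; exact hC x hx _ (update_mem_meshBox hh j ht))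
      (fun t ht => by
        unfold mixedDifference
        refine Finset.sum_congr rfl fun J hJ => ?_
        have hjJ : j ∉ J := fun h => hj (Finset.mem_powerset.1 hJ h)
        simp only [← Finset.update_piecewise_of_notMem _ _ _ hjJ]
        have := heven j (Finset.mem_insert_self _ _) x hx _
          (update_mem_meshBox (piecewise_zero_mem_meshBox hh J) j ht)
        rw [Function.update_self, Function.update_idem] at this
        rw [this])
      (mem_meshBox.1 hh j)
    rw [mixedDifference_insert _ hj, Finset.prod_insert hj]
    rw [Function.update_eq_self] at key
    calc _ ≤ _ := key
      _ = _ := by ring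

/-! ### Injectivity of the discrete operator on grid functions vanishing on the boundary -/

theorem FlatOnBoundary.eq_zero {v : (Fin d → ℝ) → ℝ} (hv : FlatOnBoundary v) {x : Fin d → ℝ}
    (hx : x ∈ cubeBoundary d) : v x = 0 := by
  have := congrArg (fun m => m 0) (hv x hx 0)
  simpa using this

instance finite_fullGrid (ℓ : Fin d → ℕ) : Finite (fullGrid ℓ) := by
  refine Set.Finite.to_subtype <| Set.Finite.subset
    (Set.Finite.pi' fun i : Fin d =>
      (Set.finite_Iic (2 ^ ℓ i)).image fun k : ℕ => (k : ℝ) * ((2 : ℝ) ^ ℓ i)⁻¹) ?_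
  rintro x ⟨hx, hgrid⟩ i
  obtain ⟨k, hk⟩ := hgrid ⟨i, Finset.mem_univ i⟩
  refine ⟨k, ?_, hk.symm⟩
  have h1 : x i ≤ 1 := hx.2 i
  change x i = k * ((2 : ℝ) ^ ℓ i)⁻¹ at hk
  rw [hk, mul_inv_le_iff₀ (by positivity), one_mul] at h1
  exact_mod_cast h1

/-- For an interior grid point, take a bump function supported away from the hyperplanes x_i = 0, 1
and from the finitely many other grid points; for a boundary point, zero suffices. -/
theorem exists_gridBump (ℓ : Fin d → ℕ) (p : fullGrid ℓ) :
    ∃ φ : (Fin d → ℝ) → ℝ, ContDiff ℝ ∞ φ ∧ (∀ x ∈ cubeBoundary d, φ =ᶠ[nhds x] 0) ∧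
      (∀ q : fullGrid ℓ, q ≠ p → φ q = 0) ∧ (p.1 ∉ cubeBoundary d → φ p = 1) := by
  by_cases hp : p.1 ∈ cubeBoundary d
  · exact ⟨0, contDiff_const, fun _ _ => Filter.EventuallyEq.rfl, fun _ _ => rfl,
      fun h => absurd hp h⟩
  have hopen : IsOpen {x : Fin d → ℝ | ∀ i, x i ≠ 0 ∧ x i ≠ 1} := by
    simp only [Set.ofPred_forall]
    exact isOpen_iInter_of_finite fun i =>
      (isOpen_ne_fun (continuous_apply i) continuous_const).inter
        (isOpen_ne_fun (continuous_apply i) continuous_const)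
  have hfin : (Subtype.val '' {q : fullGrid ℓ | q ≠ p}).Finite := Set.toFinite _
  have hpin : ∀ i, p.1 i ≠ 0 ∧ p.1 i ≠ 1 := fun i =>
    ⟨fun h => hp ⟨p.2.1, i, Or.inl h⟩, fun h => hp ⟨p.2.1, i, Or.inr h⟩⟩
  obtain ⟨φ, hsupp, -, hφ, -, hφp⟩ := exists_contDiff_tsupport_subset (n := ⊤)
    ((hopen.inter hfin.isClosed.isOpen_compl).mem_nhds (x := p.1)
      ⟨hpin, by rintro ⟨q, hq, hqp⟩; exact hq (Subtype.ext hqp)⟩)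
  refine ⟨φ, hφ, fun x hx => ?_, fun q hq => ?_, fun _ => hφp⟩
  · refine notMem_tsupport_iff_eventuallyEq.1 fun h => ?_
    obtain ⟨i, hi⟩ := hx.2
    exact hi.elim ((hsupp h).1 i).1 ((hsupp h).1 i).2
  · exact image_eq_zero_of_notMem_tsupport fun h => (hsupp h).2 ⟨q, hq, rfl⟩

/-- A combination of grid bumps, constant in the mesh sizes, interpolates the data on this one grid.
This makes arbitrary grid data with zero boundary values admissible in the solvability hypothesis.
-/
theorem exists_meshFun_sample_eq {ℓ : Fin d → ℕ}
    (b : smoothGridFun Finset.univ (Finset.univ.restrict ℓ))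
    (hb : ∀ x : fullGrid ℓ, x.1 ∈ cubeBoundary d → b.1 x = 0) :
    ∃ g : MeshFun d Finset.univ, g.sample Finset.univ ℓ = b := by
  have := Fintype.ofFinite (fullGrid ℓ)
  choose φ hφ hflat hne heq using exists_gridBump ℓ
  refine ⟨⟨fun x _ => ∑ p, b.1 p * φ p x, ?_, fun _ _ _ _ _ => rfl, fun _ _ _ _ _ _ _ => rfl,
    fun h _ x hx n => ?_⟩, Subtype.ext (funext fun x => ?_)⟩
  · exact (ContDiff.sum fun p _ => contDiff_const.mul ((hφ p).comp contDiff_fst)).contDiffOn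
  · have hz : (fun x => ∑ p, b.1 p * φ p x) =ᶠ[nhds x] fun _ => 0 := by
      filter_upwards [Filter.eventually_all.2 fun p => hflat p x hx] with y hy
      exact Finset.sum_eq_zero fun p _ => by rw [hy p]; simp
    rw [(hz.filter_mono nhdsWithin_le_nhds).iteratedFDerivWithin_eq hz.self_of_nhds]
    exact congrFun iteratedFDerivWithin_fun_zero x
  · change ∑ p, b.1 p * φ p x = b.1 x
    rw [Finset.sum_eq_single x (fun p _ hp => by rw [hne p x hp.symm, mul_zero]) (by simp)]
    by_cases hx : x.1 ∈ cubeBoundary d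
    · rw [hb x hx, zero_mul]
    · rw [heq x hx, mul_one]

/-- Rank-nullity for the restriction of `T` to `p`: its range has dimension at least that of `p`, so
its kernel is trivial. Invariance of `p` is not needed, since A_h may fail to preserve zero boundary
values. -/
theorem eq_zero_of_le_map {K V : Type*} [Field K] [AddCommGroup V] [Module K V]
    [FiniteDimensional K V] (T : V →ₗ[K] V) {p : Submodule K V} (hp : p ≤ p.map T) {x : V}
    (hx : x ∈ p) (hTx : T x = 0) : x = 0 := by
  have h₁ := LinearMap.finrank_range_add_finrank_ker (T.domRestrict p)
  have h₂ : Module.finrank K p ≤ Module.finrank K (LinearMap.range (T.domRestrict p)) := by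
    rw [LinearMap.range_domRestrict]
    exact Submodule.finrank_mono hp
  have h₃ : LinearMap.ker (T.domRestrict p) = ⊥ := Submodule.finrank_eq_zero.1 (by omega)
  have h₄ : (⟨x, hx⟩ : p) ∈ LinearMap.ker (T.domRestrict p) := by simpa using hTx
  rw [h₃, Submodule.mem_bot] at h₄
  exact congrArg Subtype.val h₄

/-- The grid functions on `I_h` that vanish on `∂I^d`. -/
def vanishingGridFun (ℓ : Fin d → ℕ) :
    Submodule ℝ (smoothGridFun Finset.univ (Finset.univ.restrict ℓ)) where
  carrier := {v | ∀ x : fullGrid ℓ, x.1 ∈ cubeBoundary d → v.1 x = 0}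
  add_mem' := fun ha hb x hx => by simp [ha x hx, hb x hx]
  zero_mem' := fun _ _ => rfl
  smul_mem' := fun c a ha x hx => by simp [ha x hx]

theorem MeshFun.sample_mem_vanishingGridFun {S : Finset (Fin d)} (w : MeshFun d S)
    (ℓ : Fin d → ℕ) : w.sample Finset.univ ℓ ∈ vanishingGridFun ℓ :=
  fun _ hx => (w.flat _ (mesh_mem_meshBox ℓ)).eq_zero hx

theorem Solvable.discrete_injOn {A : OperatorFamily d} (hA : Solvable A) {ℓ : Fin d → ℕ}
    {v w : smoothGridFun Finset.univ (Finset.univ.restrict ℓ)} (hv : v ∈ vanishingGridFun ℓ)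
    (hw : w ∈ vanishingGridFun ℓ)
    (h : A Finset.univ (Finset.univ.restrict ℓ) v = A Finset.univ (Finset.univ.restrict ℓ) w) :
    v = w := by
  refine sub_eq_zero.1 (eq_zero_of_le_map (A Finset.univ (Finset.univ.restrict ℓ))
    (p := vanishingGridFun ℓ) (fun b hb => ?_) (sub_mem hv hw) (by rw [map_sub, h, sub_self]))
  obtain ⟨g, rfl⟩ := exists_meshFun_sample_eq b hb
  obtain ⟨a, ha⟩ := hA Finset.univ g
  exact ⟨_, a.sample_mem_vanishingGridFun ℓ, ha ℓ⟩

/-! ### Families of grid functions that admit an error expansion -/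

/-- The families of grid functions of the form
`∑_j h_j² β_j + ∑_{J ≠ ∅} (∏_{j ∈ J} h_j⁴) γ_J` with uniformly bounded `β_j`, not depending on
`h_j`, and uniformly bounded `γ_J`, depending only on `h_J`. -/
def expansions (d : ℕ) : Submodule ℝ ((ℓ : Fin d → ℕ) → fullGrid ℓ → ℝ) where
  carrier := {e | ∃ (β : (j : Fin d) → (ℓ : ({j}ᶜ : Finset (Fin d)) → ℕ) → partialGrid {j}ᶜ ℓ → ℝ)
      (γ : (J : Finset (Fin d)) → (ℓ : J → ℕ) → partialGrid J ℓ → ℝ) (C : ℝ),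
      (∀ j ℓ, Measurable (β j ℓ)) ∧ (∀ j ℓ x, |β j ℓ x| ≤ C) ∧
      (∀ J ℓ, Measurable (γ J ℓ)) ∧ (∀ J ℓ x, |γ J ℓ x| ≤ C) ∧
      ∀ (ℓ : Fin d → ℕ) (x : fullGrid ℓ),
        e ℓ x = ∑ j, mesh ℓ j ^ 2 * β j (Finset.restrict {j}ᶜ ℓ) (toPartial {j}ᶜ x)
          + ∑ J ∈ (Finset.univ : Finset (Fin d)).powerset.erase ∅,
            (∏ j ∈ J, mesh ℓ j ^ 4) * γ J (J.restrict ℓ) (toPartial J x)}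
  add_mem' := by
    rintro a b ⟨β, γ, C, hβ, hβC, hγ, hγC, ha⟩ ⟨β', γ', C', hβ', hβC', hγ', hγC', hb⟩
    refine ⟨fun j ℓ x => β j ℓ x + β' j ℓ x, fun J ℓ x => γ J ℓ x + γ' J ℓ x, C + C',
      fun j ℓ => (hβ j ℓ).add (hβ' j ℓ),
      fun j ℓ x => (abs_add_le _ _).trans (add_le_add (hβC j ℓ x) (hβC' j ℓ x)),
      fun J ℓ => (hγ J ℓ).add (hγ' J ℓ),
      fun J ℓ x => (abs_add_le _ _).trans (add_le_add (hγC J ℓ x) (hγC' J ℓ x)), fun ℓ x => ?_⟩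
    simp only [Pi.add_apply, ha, hb, mul_add, Finset.sum_add_distrib]
    ring
  zero_mem' := ⟨0, 0, 0, fun _ _ => measurable_const, by simp, fun _ _ => measurable_const,
    by simp, by simp⟩
  smul_mem' := by
    rintro c a ⟨β, γ, C, hβ, hβC, hγ, hγC, ha⟩
    refine ⟨fun j ℓ x => c * β j ℓ x, fun J ℓ x => c * γ J ℓ x, |c| * C,
      fun j ℓ => (hβ j ℓ).const_mul c, fun j ℓ x => ?_,
      fun J ℓ => (hγ J ℓ).const_mul c, fun J ℓ x => ?_, fun ℓ x => ?_⟩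
    · rw [abs_mul]; exact mul_le_mul_of_nonneg_left (hβC j ℓ x) (abs_nonneg c)
    · rw [abs_mul]; exact mul_le_mul_of_nonneg_left (hγC J ℓ x) (abs_nonneg c)
    · simp only [Pi.smul_apply, smul_eq_mul, ha, mul_add, Finset.mul_sum, mul_left_comm c]

theorem sq_mul_mem_expansions (j : Fin d)
    (b : (ℓ : ({j}ᶜ : Finset (Fin d)) → ℕ) → partialGrid {j}ᶜ ℓ → ℝ) {C : ℝ}
    (hb : ∀ ℓ, Measurable (b ℓ)) (hC : ∀ ℓ x, |b ℓ x| ≤ C) :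
    (fun ℓ x => mesh ℓ j ^ 2 * b (Finset.restrict {j}ᶜ ℓ) (toPartial {j}ᶜ x))
      ∈ expansions d := by
  -- The maximum with 0 lets one constant bound the zero components as well.
  refine ⟨Pi.single j b, 0, max C 0, fun i ℓ => ?_, fun i ℓ x => ?_, fun _ _ => measurable_const,
    by simp, fun ℓ x => ?_⟩
  · rcases eq_or_ne i j with rfl | hij
    · simpa using hb ℓ
    · rw [Pi.single_eq_of_ne hij]; exact measurable_const
  · rcases eq_or_ne i j with rfl | hij
    · simpa using Or.inl (hC ℓ x)
    · rw [Pi.single_eq_of_ne hij]; simp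
  · rw [Finset.sum_eq_single j (fun i _ hij => by rw [Pi.single_eq_of_ne hij]; simp) (by simp)]
    simp

theorem prod_pow_four_mul_mem_expansions {T : Finset (Fin d)} (hT : T.Nonempty)
    (c : (ℓ : T → ℕ) → partialGrid T ℓ → ℝ) {C : ℝ}
    (hc : ∀ ℓ, Measurable (c ℓ)) (hC : ∀ ℓ x, |c ℓ x| ≤ C) :
    (fun ℓ (x : fullGrid ℓ) => (∏ j ∈ T, mesh ℓ j ^ 4) * c (T.restrict ℓ) (toPartial T x)) ∈ expansions d := by
  refine ⟨0, Pi.single T c, max C 0, fun _ _ => measurable_const, by simp, fun J ℓ => ?_,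
    fun J ℓ x => ?_, fun ℓ x => ?_⟩
  · rcases eq_or_ne J T with rfl | hJ
    · simpa using hc ℓ
    · rw [Pi.single_eq_of_ne hJ]; exact measurable_const
  · rcases eq_or_ne J T with rfl | hJ
    · simpa using Or.inl (hC ℓ x)
    · rw [Pi.single_eq_of_ne hJ]; simp
  · rw [Finset.sum_eq_single T (s := Finset.powerset _ |>.erase ∅)
      (fun J _ hJ => by rw [Pi.single_eq_of_ne hJ]; simp) (fun h => absurd h (by
        simpa using hT.ne_empty))]
    simp

/-- The mesh sizes in the directions of `S`, extended by zero to all directions. -/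
noncomputable def extendMesh (S : Finset (Fin d)) (ℓ : S → ℕ) : Fin d → ℝ :=
  fun i => if hi : i ∈ S then ((2 : ℝ) ^ ℓ ⟨i, hi⟩)⁻¹ else 0

theorem extendMesh_mem_Icc (S : Finset (Fin d)) (ℓ : S → ℕ) (i : Fin d) :
    extendMesh S ℓ i ∈ Set.Icc (0 : ℝ) 1 := by
  unfold extendMesh
  split_ifs
  · exact ⟨by positivity, inv_le_one_of_one_le₀ (one_le_pow₀ (by norm_num))⟩
  · norm_num

theorem extendMesh_mem_meshBox (S : Finset (Fin d)) (ℓ : S → ℕ) :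
    extendMesh S ℓ ∈ meshBox d :=
  mem_meshBox.2 fun i => Set.Icc_subset_Icc_left (by norm_num) (extendMesh_mem_Icc S ℓ i)

theorem extendMesh_restrict {S : Finset (Fin d)} (ℓ : Fin d → ℕ) {i : Fin d} (hi : i ∈ S) :
    extendMesh S (S.restrict ℓ) i = mesh ℓ i := by
  simp [extendMesh, hi, mesh]

theorem measurable_comp_partialGrid {v : (Fin d → ℝ) → ℝ} (hv : ContinuousOn v (cube d))
    (S : Finset (Fin d)) (ℓ : S → ℕ) : Measurable fun x : partialGrid S ℓ => v x :=
  (continuousOn_iff_continuous_domRestrict.1 (hv.mono fun _ hx => hx.1)).measurable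

theorem MeshFun.exists_bound {S : Finset (Fin d)} (w : MeshFun d S) :
    ∃ C, ∀ x ∈ cube d, ∀ h ∈ meshBox d, |w.toFun x h| ≤ C := by
  obtain ⟨C, hC⟩ :=
    isCompact_cube_prod_meshBox.exists_bound_of_continuousOn w.smooth.continuousOn
  exact ⟨C, fun x hx h hh => hC (x, h) ⟨hx, hh⟩⟩

/-- For any j in `J`, the mesh size h_j enters only through the factor h_j². The remaining squares
are at most 1 and are absorbed into β_j. -/
theorem MeshFun.prod_mul_piecewise_mem_expansions {T J : Finset (Fin d)} (w : MeshFun d T)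
    (hJT : J ⊆ T) (hJ : J.Nonempty) :
    (fun ℓ (x : fullGrid ℓ) => (∏ j ∈ T, mesh ℓ j ^ 2) * w.toFun x (J.piecewise 0 (mesh ℓ)))
      ∈ expansions d := by
  obtain ⟨j, hj⟩ := hJ
  obtain ⟨C, hC⟩ := w.exists_bound
  have hbox : ∀ ℓ, J.piecewise 0 (extendMesh ({j}ᶜ : Finset (Fin d)) ℓ) ∈ meshBox d := fun ℓ =>
    piecewise_zero_mem_meshBox (extendMesh_mem_meshBox _ ℓ) J
  convert sq_mul_mem_expansions j
    (fun ℓ x => (∏ i ∈ T.erase j, extendMesh {j}ᶜ ℓ i ^ 2) *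
      w.toFun x (J.piecewise 0 (extendMesh {j}ᶜ ℓ))) (C := C)
    (fun ℓ => (measurable_comp_partialGrid (w.contDiffOn_slice (hbox ℓ)).continuousOn _ ℓ).const_mul
      _) (fun ℓ x => ?_) using 1
  · funext ℓ x
    have h₁ : ∏ i ∈ T.erase j, extendMesh {j}ᶜ (Finset.restrict {j}ᶜ ℓ) i ^ 2
        = ∏ i ∈ T.erase j, mesh ℓ i ^ 2 := Finset.prod_congr rfl fun i hi => by
      rw [extendMesh_restrict ℓ (by simpa using (Finset.mem_erase.1 hi).1)]
    have h₂ : J.piecewise 0 (extendMesh {j}ᶜ (Finset.restrict {j}ᶜ ℓ))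
        = J.piecewise 0 (mesh ℓ) := funext fun i => by
      by_cases hi : i ∈ J
      · simp [hi]
      · have hij : i ≠ j := fun h => hi (h ▸ hj)
        simp only [Finset.piecewise_eq_of_notMem _ _ _ hi]
        exact extendMesh_restrict ℓ (by simpa using hij)
    rw [h₁, h₂, ← mul_assoc, Finset.mul_prod_erase T (fun i => mesh ℓ i ^ 2) (hJT hj)]
    rfl
  · have hI := extendMesh_mem_Icc {j}ᶜ ℓ
    have hp : |∏ i ∈ T.erase j, extendMesh {j}ᶜ ℓ i ^ 2| ≤ 1 := by
      rw [abs_of_nonneg (Finset.prod_nonneg fun i _ => sq_nonneg _)]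
      exact Finset.prod_le_one (fun i _ => sq_nonneg _) fun i _ =>
        pow_le_one₀ (hI i).1 (hI i).2
    rw [abs_mul]
    have := hC x x.2.1 _ (hbox ℓ)
    exact (mul_le_of_le_one_left (abs_nonneg _) hp).trans this

/-- Here γ_T is the mixed difference divided by h_T², bounded by the evenness estimate. It depends
on h_T alone because `w` does. -/
theorem MeshFun.prod_mul_mixedDifference_mem_expansions {T : Finset (Fin d)} (w : MeshFun d T)
    (hT : T.Nonempty) :
    (fun ℓ (x : fullGrid ℓ) => (∏ j ∈ T, mesh ℓ j ^ 2) * mixedDifference w.toFun T x (mesh ℓ))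
      ∈ expansions d := by
  obtain ⟨C, hC⟩ := exists_mixedDifference_le T w.toFun w.smooth
    fun i _ x hx h hh => w.even x hx h hh i
  have hpos : ∀ ℓ : T → ℕ, 0 < ∏ j ∈ T, extendMesh T ℓ j ^ 2 := fun ℓ =>
    Finset.prod_pos fun j hj => by simp only [extendMesh, hj, dif_pos]; positivity
  have hprod : ∀ ℓ : Fin d → ℕ,
      ∏ j ∈ T, extendMesh T (T.restrict ℓ) j ^ 2 = ∏ j ∈ T, mesh ℓ j ^ 2 := fun ℓ =>
    Finset.prod_congr rfl fun j hj => by rw [extendMesh_restrict ℓ hj]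
  convert prod_pow_four_mul_mem_expansions hT
    (fun ℓ x => mixedDifference w.toFun T x (extendMesh T ℓ) / ∏ j ∈ T, extendMesh T ℓ j ^ 2)
    (C := C) (fun ℓ => Measurable.div_const ?_ _) (fun ℓ x => ?_) using 1
  · funext ℓ x
    have h₁ : mixedDifference w.toFun T x (extendMesh T (T.restrict ℓ))
        = mixedDifference w.toFun T x (mesh ℓ) := by
      refine Finset.sum_congr rfl fun J _ => ?_
      rw [w.dependsOn x x.2.1 _ (piecewise_zero_mem_meshBox (extendMesh_mem_meshBox _ _) J) _
        (piecewise_zero_mem_meshBox (mesh_mem_meshBox ℓ) J) fun i hi => ?_]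
      by_cases hiJ : i ∈ J
      · simp [hiJ]
      · simp [hiJ, extendMesh_restrict ℓ hi]
    have h₂ : ∏ j ∈ T, mesh ℓ j ^ 4 = (∏ j ∈ T, mesh ℓ j ^ 2) * ∏ j ∈ T, mesh ℓ j ^ 2 := by
      rw [← Finset.prod_mul_distrib]
      exact Finset.prod_congr rfl fun j _ => by ring
    have h₃ := (hpos (T.restrict ℓ)).ne'
    change _ = _ * (mixedDifference w.toFun T x (extendMesh T (T.restrict ℓ)) / _)
    rw [h₁, h₂]
    rw [hprod] at h₃ ⊢
    rw [mul_assoc, mul_div_cancel₀ _ h₃]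
  · refine measurable_comp_partialGrid (v := fun x => mixedDifference w.toFun T x _) ?_ T ℓ
    exact continuousOn_finsetSum _ fun J _ => continuousOn_const.mul (w.contDiffOn_slice
      (piecewise_zero_mem_meshBox (extendMesh_mem_meshBox T ℓ) J)).continuousOn
  · rw [abs_div, abs_of_pos (hpos ℓ), div_le_iff₀ (hpos ℓ)]
    exact hC x x.2.1 _ (extendMesh_mem_meshBox T ℓ)

/-- The summand J = ∅ of the mixed difference is `w` itself; every other summand freezes some mesh
size at zero. -/
theorem MeshFun.prod_mul_mem_expansions {T : Finset (Fin d)} (w : MeshFun d T)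
    (hT : T.Nonempty) :
    (fun ℓ (x : fullGrid ℓ) => (∏ j ∈ T, mesh ℓ j ^ 2) * w.toFun x (mesh ℓ)) ∈ expansions d := by
  have key := sub_mem (w.prod_mul_mixedDifference_mem_expansions hT)
    (Submodule.sum_mem (expansions d) (t := T.powerset.erase ∅)
      (f := fun J => (-1 : ℝ) ^ J.card •
        fun ℓ (x : fullGrid ℓ) => (∏ j ∈ T, mesh ℓ j ^ 2) * w.toFun x (J.piecewise 0 (mesh ℓ)))
      fun J hJ => by
        rw [Finset.mem_erase, Finset.mem_powerset] at hJ
        exact Submodule.smul_mem _ _ (w.prod_mul_piecewise_mem_expansions hJ.2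
          (Finset.nonempty_iff_ne_empty.2 hJ.1)))
  convert key using 1
  funext ℓ x
  simp only [Pi.sub_apply, Finset.sum_apply, Pi.smul_apply, smul_eq_mul, mixedDifference]
  rw [← Finset.add_sum_erase _ _ (Finset.empty_mem_powerset T), mul_add, Finset.mul_sum]
  simp only [mul_left_comm]
  simp

/-! ### Expansion of the discrete solutions -/

/-- Correcting `w` by discrete solutions for the truncation error terms yields a discrete
solution. -/
theorem discrete_correction_apply {A : OperatorFamily d} {S : Finset (Fin d)} {w : MeshFun d S}
    {σ : (J : Finset (Fin d)) → MeshFun d (J ∪ S)} {ℓ : Fin d → ℕ}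
    {e : Finset (Fin d) → smoothGridFun Finset.univ (Finset.univ.restrict ℓ)}
    (he : ∀ J ∈ Sᶜ.powerset.erase ∅,
      A Finset.univ (Finset.univ.restrict ℓ) (e J) = (σ J).sample Finset.univ ℓ)
    {x : fullGrid ℓ}
    (hσ : (A S (S.restrict ℓ) (w.sample S ℓ)).1 (toPartial S x)
          - (A Finset.univ (Finset.univ.restrict ℓ) (w.sample Finset.univ ℓ)).1 x
        = ∑ J ∈ Sᶜ.powerset.erase ∅, (∏ j ∈ J, mesh ℓ j ^ 2) * (σ J).toFun x (mesh ℓ)) :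
    (A Finset.univ (Finset.univ.restrict ℓ) (w.sample Finset.univ ℓ
        + ∑ J ∈ Sᶜ.powerset.erase ∅, (∏ j ∈ J, mesh ℓ j ^ 2) • e J)).1 x
      = (A S (S.restrict ℓ) (w.sample S ℓ)).1 (toPartial S x) := by
  rw [map_add, map_sum, Finset.sum_congr rfl fun J hJ => by rw [map_smul, he J hJ]]
  rw [← sub_add_cancel ((A S (S.restrict ℓ) (w.sample S ℓ)).1 (toPartial S x)), hσ, add_comm]
  simp only [Submodule.coe_add, Submodule.coe_sum, Submodule.coe_smul, Pi.add_apply,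
    Finset.sum_apply, Pi.smul_apply, smul_eq_mul]
  rfl

/-- Induction on the number of directions not yet discretised. The weight h_S² is carried along so
that a correction h_J² e_J acquires the weight h_{J ∪ S}², with `J` and `S` disjoint, as the
induction hypothesis requires. -/
theorem exists_discrete_solution {A : OperatorFamily d} (hsolv : Solvable A)
    (htrunc : TruncationExpansion A) (S : Finset (Fin d)) (hS : S.Nonempty) (g : MeshFun d S) :
    ∃ e : (ℓ : Fin d → ℕ) → smoothGridFun Finset.univ (Finset.univ.restrict ℓ),
      (∀ ℓ, e ℓ ∈ vanishingGridFun ℓ) ∧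
      (∀ ℓ, A Finset.univ (Finset.univ.restrict ℓ) (e ℓ) = g.sample Finset.univ ℓ) ∧
      (fun ℓ (x : fullGrid ℓ) => (∏ j ∈ S, mesh ℓ j ^ 2) * (e ℓ).1 x) ∈ expansions d := by
  induction hn : Sᶜ.card using Nat.strong_induction_on generalizing S with
  | _ n ih =>
  subst hn
  obtain ⟨w, hw⟩ := hsolv S g
  obtain ⟨σ, hσ⟩ := htrunc S w
  -- Membership of `J` is placed under the existential so that `choose` yields a family over all
  -- `J`; the value 0 elsewhere is never used.
  have hex : ∀ J, ∃ e : (ℓ : Fin d → ℕ) → smoothGridFun Finset.univ (Finset.univ.restrict ℓ),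
      J ∈ Sᶜ.powerset.erase ∅ → (∀ ℓ, e ℓ ∈ vanishingGridFun ℓ) ∧
      (∀ ℓ, A Finset.univ (Finset.univ.restrict ℓ) (e ℓ) = (σ J).sample Finset.univ ℓ) ∧
      (fun ℓ (x : fullGrid ℓ) => (∏ j ∈ J ∪ S, mesh ℓ j ^ 2) * (e ℓ).1 x) ∈ expansions d := by
    intro J
    by_cases hJ : J ∈ Sᶜ.powerset.erase ∅
    · obtain ⟨hJ₀, hJS⟩ := Finset.mem_erase.1 hJ
      obtain ⟨j, hj⟩ := Finset.nonempty_iff_ne_empty.2 hJ₀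
      have hlt : (J ∪ S)ᶜ.card < Sᶜ.card := Finset.card_lt_card <| Finset.compl_ssubset_compl.2
        ⟨Finset.subset_union_right, fun h =>
          Finset.mem_compl.1 (Finset.mem_powerset.1 hJS hj) (h (Finset.mem_union_left _ hj))⟩
      obtain ⟨e, he⟩ := ih _ hlt (J ∪ S) (hS.mono Finset.subset_union_right) (σ J) rfl
      exact ⟨e, fun _ => he⟩
    · exact ⟨0, fun h => absurd h hJ⟩
  choose e he using hex
  refine ⟨fun ℓ => w.sample Finset.univ ℓ
    + ∑ J ∈ Sᶜ.powerset.erase ∅, (∏ j ∈ J, mesh ℓ j ^ 2) • e J ℓ, fun ℓ => ?_, fun ℓ => ?_, ?_⟩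
  · exact add_mem (w.sample_mem_vanishingGridFun ℓ)
      (Submodule.sum_mem _ fun J hJ => Submodule.smul_mem _ _ ((he J hJ).1 ℓ))
  · refine Subtype.ext (funext fun x => ?_)
    rw [discrete_correction_apply (fun J hJ => (he J hJ).2.1 ℓ) (hσ ℓ x), hw ℓ]
    rfl
  · have key := add_mem (w.prod_mul_mem_expansions hS)
      (Submodule.sum_mem _ fun J hJ => (he J hJ).2.2)
    convert key using 1
    funext ℓ x
    simp only [Submodule.coe_add, Submodule.coe_sum, Submodule.coe_smul, Pi.add_apply,
      Finset.sum_apply, Pi.smul_apply, smul_eq_mul, mul_add, Finset.mul_sum]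
    refine congrArg₂ _ rfl (Finset.sum_congr rfl fun J hJ => ?_)
    have hdisj : Disjoint J S := by
      rw [Finset.mem_erase, Finset.mem_powerset] at hJ
      exact Finset.disjoint_left.2 fun j hj => Finset.mem_compl.1 (hJ.2 hj)
    rw [Finset.prod_union hdisj]
    ring

/-- A smooth function that is flat on the boundary, as a function without mesh sizes. -/
def MeshFun.ofFlat (u : (Fin d → ℝ) → ℝ) (hu : ContDiffOn ℝ ∞ u (cube d))
    (hflat : FlatOnBoundary u) : MeshFun d ∅ where
  toFun x _ := u x
  smooth := hu.comp contDiff_fst.contDiffOn fun _ hp => hp.1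
  even _ _ _ _ _ := rfl
  dependsOn _ _ _ _ _ _ _ := rfl
  flat _ _ := hflat

end SparseGrid

open SparseGrid

theorem mainTheorem3 (d : ℕ) (A : SparseGrid.OperatorFamily d)
    (hsolv : SparseGrid.Solvable A) (htrunc : SparseGrid.TruncationExpansion A)
    (u f : (Fin d → ℝ) → ℝ)
    (hu : ContDiffOn ℝ ∞ u (SparseGrid.cube d)) (hf : ContDiffOn ℝ ∞ f (SparseGrid.cube d))
    (hu_flat : SparseGrid.FlatOnBoundary u)
    (hAu : ∀ ℓ : (∅ : Finset (Fin d)) → ℕ,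
      A ∅ ℓ (SparseGrid.sample u hu ∅ ℓ) = SparseGrid.sample f hf ∅ ℓ) :
    ∃ (β : (j : Fin d) → (ℓ : ({j}ᶜ : Finset (Fin d)) → ℕ) →
          SparseGrid.partialGrid {j}ᶜ ℓ → ℝ)
      (γ : (J : Finset (Fin d)) → (ℓ : J → ℕ) → SparseGrid.partialGrid J ℓ → ℝ)
      (C : ℝ),
      (∀ j ℓ, Measurable (β j ℓ)) ∧ (∀ j ℓ x, |β j ℓ x| ≤ C) ∧
      (∀ J ℓ, Measurable (γ J ℓ)) ∧ (∀ J ℓ x, |γ J ℓ x| ≤ C) ∧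
      ∀ (ℓ : Fin d → ℕ)
        (uh : SparseGrid.smoothGridFun Finset.univ (Finset.univ.restrict ℓ)),
        A Finset.univ (Finset.univ.restrict ℓ) uh
            = SparseGrid.sample f hf Finset.univ (Finset.univ.restrict ℓ) →
        (∀ x : SparseGrid.fullGrid ℓ, x.1 ∈ SparseGrid.cubeBoundary d → uh.1 x = 0) →
        ∀ x : SparseGrid.fullGrid ℓ,
          u x - uh.1 x
            = ∑ j, SparseGrid.mesh ℓ j ^ 2
                * β j (Finset.restrict {j}ᶜ ℓ) (SparseGrid.toPartial {j}ᶜ x)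
              + ∑ J ∈ (Finset.univ : Finset (Fin d)).powerset.erase ∅,
                (∏ j ∈ J, SparseGrid.mesh ℓ j ^ 4)
                  * γ J (J.restrict ℓ) (SparseGrid.toPartial J x) := by

  -- This is the correction step for S = ∅, with `u` itself as the solution. It is separate because
  -- the unweighted term `u` is not an expansion but cancels in u - u_h.
  let w := MeshFun.ofFlat u hu hu_flat
  obtain ⟨σ, hσ⟩ := htrunc ∅ w
  have hex : ∀ J, ∃ e : (ℓ : Fin d → ℕ) → smoothGridFun Finset.univ (Finset.univ.restrict ℓ),
      J ∈ (∅ : Finset (Fin d))ᶜ.powerset.erase ∅ → (∀ ℓ, e ℓ ∈ vanishingGridFun ℓ) ∧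
      (∀ ℓ, A Finset.univ (Finset.univ.restrict ℓ) (e ℓ) = (σ J).sample Finset.univ ℓ) ∧
      (fun ℓ (x : fullGrid ℓ) => (∏ j ∈ J ∪ ∅, mesh ℓ j ^ 2) * (e ℓ).1 x) ∈ expansions d := by
    intro J
    by_cases hJ : J ∈ (∅ : Finset (Fin d))ᶜ.powerset.erase ∅
    · obtain ⟨e, he⟩ := exists_discrete_solution hsolv htrunc (J ∪ ∅)
        (by simpa using Finset.nonempty_iff_ne_empty.2 (Finset.mem_erase.1 hJ).1) (σ J)
      exact ⟨e, fun _ => he⟩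
    · exact ⟨0, fun h => absurd h hJ⟩
  choose e he using hex
  -- The sign comes from u_h = u + ∑ h_J² e_J. The coefficients are fixed here, before the mesh and
  -- `uh` are introduced.
  obtain ⟨β, γ, C, hβ, hβC, hγ, hγC, hexp⟩ := neg_mem (Submodule.sum_mem (expansions d)
    fun J hJ => (he J hJ).2.2)
  refine ⟨β, γ, C, hβ, hβC, hγ, hγC, fun ℓ uh huh hzero x => ?_⟩
  rw [← hexp]
  -- Both sides vanish on the boundary and are mapped by A_h to `f`, so injectivity identifies them.
  have huh_eq : uh = w.sample Finset.univ ℓ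
      + ∑ J ∈ (∅ : Finset (Fin d))ᶜ.powerset.erase ∅, (∏ j ∈ J, mesh ℓ j ^ 2) • e J ℓ := by
    refine hsolv.discrete_injOn (ℓ := ℓ) hzero (add_mem (w.sample_mem_vanishingGridFun ℓ)
      (Submodule.sum_mem _ fun J hJ => Submodule.smul_mem _ _ ((he J hJ).1 ℓ))) ?_
    refine Subtype.ext (funext fun y => ?_)
    rw [huh, discrete_correction_apply (fun J hJ => (he J hJ).2.1 ℓ) (hσ ℓ y)]
    exact (congrArg (fun v => v.1 (toPartial ∅ y)) (hAu (Finset.restrict ∅ ℓ))).symm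
  rw [huh_eq]
  simp only [Submodule.coe_add, Submodule.coe_sum, Submodule.coe_smul, Pi.add_apply, Pi.neg_apply,
      Finset.sum_apply, Pi.smul_apply, smul_eq_mul, Finset.union_empty]
  change u x - (u x + _) = _
  ring
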